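/- Let $H$ be a complex Hilbert space, let $Q$ be a bounded nonnegative selfadjoint operator on $H$ with $\ker Q=\{0\}$ and $\operatorname{ran} Q\neq H$, and let $M\subsetneq H$ be a proper closed subspace with $M^{\perp}\cap\operatorname{ran}Q=\{0\}$. Let $P_M$ be the orthogonal projection onto $M$ and let \[ Z_0:=i\,Q^{-1}\bigl(QP_MQ\bigr)^{1/2}, \] which is an everywhere defined bounded operator on $H$. For $t\ge 0$ set \[ Z_0(t):=Z_0\exp\bigl(-t(I-Z_0^2)\bigr). \] An (unbounded) operator $A$ on $H$ is called $m$-accretive if it is densely defined, $\operatorname{Re}(Au,u)\ge 0$ for all $u\in\operatorname{dom}A$, and $\operatorname{ran}(A-\lambda I)=H$ for some $\lambda\in\mathbb C$ with $\operatorname{Re}\lambda<0$; its square root $A^{1/2}$ is the unique $m$-accretive operator $S$ with $S^2=A$. Write $B^{*1/2}:=(B^*)^{1/2}$. Then for every $t\ge 0$ the bounded operators $Q(I+Z_0(t))(I-Z_0(t)^*)Q$ and $Q(I+Z_0(t))$ are injective, and the operator \[ B_0(t):=\bigl(Q(I+Z_0(t))(I-Z_0(t)^*)Q\bigr)^{-1}=\bigl(Q(I+Z_0(t))Q(I+Z_0(t))\bigr)^{-1}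 \] is $m$-accretive. The operators $B_0(t)$ and $B_0(t)^*$ have (unique) $m$-accretive square roots, \[ B_0(t)^{1/2}=\bigl(Q(I+Z_0(t))\bigr)^{-1}=\bigl((I-Z_0(t)^*)Q\bigr)^{-1}, \] and \[ \operatorname{dom}B_0(t)^{1/2}\neq\operatorname{dom}B_0(t)^{*1/2}\qquad\text{for every } t\ge 0 . \] The family $t\mapsto B_0(t)$ is norm-resolvent continuous on $[0,\infty)$: for every $t_0\ge 0$ the resolvent set $\rho(B_0(t_0))$ is non-empty, and for every $\lambda\in\rho(B_0(t_0))$ one has $\lambda\in\rho(B_0(t))$ for all $t\ge 0$ close enough to $t_0$ and $(B_0(t)-\lambda I)^{-1}\to(B_0(t_0)-\lambda I)^{-1}$ in operator norm as $t\to t_0$. If, in addition, $M\cap\operatorname{ran}Q=\{0\}$, then $\operatorname{dom}B_0(t)\cap\operatorname{dom}B_0(t)^*=\{0\}$ for every $t\ge 0$. -/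

import Mathlib

open scoped InnerProductSpace Topology LinearPMap
open Filter

noncomputable section

namespace KatoSqrt

variable {H : Type*} [NormedAddCommGroup H] [InnerProductSpace ℂ H]

/-! ### Unbounded operators -/

/-- `A` is accretive: `Re (A u, u) ≥ 0` for all `u ∈ dom A`. -/
def IsAccretive (A : H →ₗ.[ℂ] H) : Prop :=
  ∀ u : A.domain, 0 ≤ (⟪(u : H), A u⟫_ℂ).re

/-- `A` is `m`-accretive: it is accretive, densely defined, and `ran (A - λ I) = H` for some `λ`
with `Re λ < 0`. -/
structure IsMAccretive (A : H →ₗ.[ℂ] H) : Prop where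
  accretive : IsAccretive A
  dense_domain : Dense (A.domain : Set H)
  surjective : ∃ l : ℂ, l.re < 0 ∧ ∀ y : H, ∃ u : A.domain, A u - l • (u : H) = y

/-- `S` is an `m`-accretive square root of `B`: `S` is `m`-accretive and `S ∘ S = B` as unbounded
operators (the domain of `S ∘ S` is `{x ∈ dom S | S x ∈ dom S}`), expressed through graphs. -/
structure IsMAccretiveSqrt (B S : H →ₗ.[ℂ] H) : Prop where
  isMAccretive : IsMAccretive S
  mem_graph_iff : ∀ x y : H,
    (x, y) ∈ B.graph ↔ ∃ z : H, (x, z) ∈ S.graph ∧ (z, y) ∈ S.graph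

/-- The square root `B^{1/2}`: the `m`-accretive square root of `B`
(an arbitrary operator when `B` has none). -/
def mSqrt (B : H →ₗ.[ℂ] H) : H →ₗ.[ℂ] H :=
  Classical.epsilon (IsMAccretiveSqrt B)

/-- The inverse `T⁻¹` of an injective everywhere defined bounded operator `T`, as an unbounded
operator with domain `ran T`. -/
def opInv (T : H →L[ℂ] H) : H →ₗ.[ℂ] H :=
  ((T : H →ₗ[ℂ] H).toPMap ⊤).inverse

/-- `R` is the resolvent `(A - λ I)⁻¹`: a bounded everywhere defined two-sided inverse of
`A - λ I`. -/
structure IsResolventAt (A : H →ₗ.[ℂ] H) (l : ℂ) (R : H →L[ℂ] H) : Prop where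
  right_inv : ∀ y : H, ∃ u : A.domain, (u : H) = R y ∧ A u - l • (u : H) = y
  left_inv : ∀ u : A.domain, R (A u - l • (u : H)) = u

/-- Norm-resolvent continuity on `s` of a family of operators with non-empty resolvent sets: for
every `t₀ ∈ s` and every `λ` in the resolvent set of `B t₀`, the point `λ` is in the resolvent set
of `B t` for `t ∈ s` close to `t₀`, and `(B t - λ I)⁻¹ → (B t₀ - λ I)⁻¹` in operator norm as
`t → t₀` in `s`. -/
def NormResolventContinuousOn (B : ℝ → (H →ₗ.[ℂ] H)) (s : Set ℝ) : Prop :=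
  ∀ t₀ ∈ s, (∃ l R₀, IsResolventAt (B t₀) l R₀) ∧
    ∀ l R₀, IsResolventAt (B t₀) l R₀ →
      ∃ R : ℝ → (H →L[ℂ] H),
        (∀ᶠ t in 𝓝[s] t₀, IsResolventAt (B t) l (R t)) ∧ Tendsto R (𝓝[s] t₀) (𝓝 R₀)

/-! ### The operators `Z₀`, `Z₀(t)` and `B₀(t)` -/

variable [CompleteSpace H]

/-- `(Q P_M Q)^{1/2}`, where `P_M` is the orthogonal projection onto `M`. -/
def sqrtQPQ (Q : H →L[ℂ] H) (M : Submodule ℂ H) [M.HasOrthogonalProjection] : H →L[ℂ] H :=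
  CFC.sqrt (Q * M.starProjection * Q)

theorem norm_sqrtQPQ_apply_le {Q : H →L[ℂ] H} (hQ : Q.IsPositive)
    (M : Submodule ℂ H) [M.HasOrthogonalProjection] (x : H) :
    ‖sqrtQPQ Q M x‖ ≤ ‖Q x‖ := by
  have hPpos : (0 : H →L[ℂ] H) ≤ M.starProjection :=
    (isStarProjection_starProjection (U := M)).nonneg
  have hQs : star Q = Q := hQ.isSelfAdjoint.star_eq
  have hnn : 0 ≤ Q * M.starProjection * Q := by
    have := star_left_conjugate_nonneg hPpos Q
    rwa [hQs] at this
  have hS : star (sqrtQPQ Q M) = sqrtQPQ Q M :=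
    (IsSelfAdjoint.of_nonneg (CFC.sqrt_nonneg (Q * M.starProjection * Q))).star_eq
  have hSS : sqrtQPQ Q M * sqrtQPQ Q M = Q * M.starProjection * Q :=
    CFC.sqrt_mul_sqrt_self _ hnn
  have key : ‖sqrtQPQ Q M x‖ ^ 2 ≤ ‖Q x‖ ^ 2 := by
    have h1 : ((‖sqrtQPQ Q M x‖ ^ 2 : ℝ) : ℂ) = ⟪M.starProjection (Q x), Q x⟫_ℂ := by
      have h2 : ⟪sqrtQPQ Q M x, sqrtQPQ Q M x⟫_ℂ = ⟪(sqrtQPQ Q M * sqrtQPQ Q M) x, x⟫_ℂ := by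
        rw [← ContinuousLinearMap.adjoint_inner_left, ← ContinuousLinearMap.star_eq_adjoint, hS]
        rfl
      rw [hSS] at h2
      have h3 : ⟪(Q * M.starProjection * Q) x, x⟫_ℂ = ⟪M.starProjection (Q x), Q x⟫_ℂ := by
        conv_lhs => rw [← hQs]
        rw [ContinuousLinearMap.star_eq_adjoint]
        change ⟪ContinuousLinearMap.adjoint Q _, x⟫_ℂ = _
        rw [ContinuousLinearMap.adjoint_inner_left, ← ContinuousLinearMap.star_eq_adjoint, hQs]
        rfl
      rw [← h3, ← h2, inner_self_eq_norm_sq_to_K]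
      norm_cast
    have h4 : ‖sqrtQPQ Q M x‖ ^ 2 = ‖⟪M.starProjection (Q x), Q x⟫_ℂ‖ := by
      rw [← h1, Complex.norm_real, Real.norm_of_nonneg (sq_nonneg _)]
    rw [h4]
    calc _ ≤ ‖M.starProjection (Q x)‖ * ‖Q x‖ := norm_inner_le_norm _ _
      _ ≤ ‖Q x‖ * ‖Q x‖ := by
        gcongr
        exact M.norm_starProjection_apply_le _
      _ = _ := by ring
  exact le_of_sq_le_sq key (norm_nonneg _)

/-- The operator `Q⁻¹ (Q P_M Q)^{1/2}` is everywhere defined and bounded. -/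
theorem exists_Z₀ {Q : H →L[ℂ] H} (hQ : Q.IsPositive) (hker : Function.Injective Q)
    (M : Submodule ℂ H) [M.HasOrthogonalProjection] :
    ∃ Z : H →L[ℂ] H, ∀ x, Q (Z x) = Complex.I • sqrtQPQ Q M x := by
  have hQs : star Q = Q := hQ.isSelfAdjoint.star_eq
  have hS : star (sqrtQPQ Q M) = sqrtQPQ Q M :=
    (IsSelfAdjoint.of_nonneg (CFC.sqrt_nonneg (Q * M.starProjection * Q))).star_eq
  have hdense : DenseRange (Q : H →ₗ[ℂ] H) := by
    have h := ContinuousLinearMap.orthogonal_range Q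
    rw [← ContinuousLinearMap.star_eq_adjoint, hQs, LinearMap.ker_eq_bot.mpr hker] at h
    have h2 := (Submodule.dense_iff_topologicalClosure_eq_top).mpr
      ((Submodule.topologicalClosure_eq_top_iff).mpr h)
    have h3 : Set.range (Q : H →ₗ[ℂ] H) = (LinearMap.range (Q : H →ₗ[ℂ] H) : Set H) := by
      ext; simp
    rw [DenseRange, h3]
    exact h2
  set V : H →L[ℂ] H :=
    (sqrtQPQ Q M : H →ₗ[ℂ] H).extendOfNorm (Q : H →ₗ[ℂ] H) with hV
  have hVQ : V * Q = sqrtQPQ Q M := by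
    ext x
    exact LinearMap.extendOfNorm_eq hdense
      ⟨1, fun x => by simpa using norm_sqrtQPQ_apply_le hQ M x⟩ x
  refine ⟨Complex.I • star V, fun x => ?_⟩
  have h : Q * star V = sqrtQPQ Q M := by
    have := congrArg star hVQ
    rwa [star_mul, hQs, hS] at this
  have hx := congrArg (fun T : H →L[ℂ] H => T x) h
  simpa using congrArg (fun y => Complex.I • y) hx

/-- `Z₀ = i Q⁻¹ (Q P_M Q)^{1/2}`: the bounded operator with `Q Z₀ = i (Q P_M Q)^{1/2}`, which is
unique because `Q` is injective. -/
def Z₀ {Q : H →L[ℂ] H} (hQ : Q.IsPositive) (hker : Function.Injective Q)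
    (M : Submodule ℂ H) [M.HasOrthogonalProjection] : H →L[ℂ] H :=
  (exists_Z₀ hQ hker M).choose

/-- `Z₀(t) = Z₀ exp(-t (I - Z₀²))`. -/
def Z₀t {Q : H →L[ℂ] H} (hQ : Q.IsPositive) (hker : Function.Injective Q)
    (M : Submodule ℂ H) [M.HasOrthogonalProjection] (t : ℝ) : H →L[ℂ] H :=
  Z₀ hQ hker M * NormedSpace.exp (-(t : ℂ) • (1 - Z₀ hQ hker M ^ 2))

/-- `B₀(t) = (Q (I + Z₀(t)) (I - Z₀(t)*) Q)⁻¹`. -/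
def B₀ {Q : H →L[ℂ] H} (hQ : Q.IsPositive) (hker : Function.Injective Q)
    (M : Submodule ℂ H) [M.HasOrthogonalProjection] (t : ℝ) : H →ₗ.[ℂ] H :=
  opInv (Q * (1 + Z₀t hQ hker M t) * (1 - star (Z₀t hQ hker M t)) * Q)

end KatoSqrt

end

open scoped InnerProductSpace Topology LinearPMap
open Filter

noncomputable section

namespace KatoSqrt

variable {H : Type*} [NormedAddCommGroup H] [InnerProductSpace ℂ H]

/-! ### Inverses of injective bounded operators -/

/-! Everything reduces to bounded operators `R = Q (1 + K)` with `Q K` skew-adjoint, i.e. `Q K = -K*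
Q`. Then `R = (1 - K*) Q`, the real part of `R` is `Q`, and `R*` is the same expression with `-K`;
hence `R` is injective with dense range, and `B = (R²)⁻¹` has the square root `R⁻¹`. If `‖K‖ ≤ 1`,
then `R²` is accretive.

For `Z = Z₀`, skew-adjointness comes from `Q Z = i (Q P Q)^{1/2}`. Cancelling `Q` in `Q Z Z* Q = Q P
Q` gives `Z Z* = P`, and `Mᗮ ∩ ran Q = 0` makes `Z` injective, so `Z` is an isometry, not unitary
because `M ≠ H`. The factor `exp(-t (1 - Z²))` keeps the skew relation (`mul_expTwist_eq`) and
contractivity (`norm_expTwist_le`), and `1 - K` remains non-invertible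
(`not_isUnit_one_sub_expTwist`).

The domains of the two square roots are `ran Q (1 + K)` and `ran Q (1 - K)`; if they agreed, `1 - K`
would be invertible (`domain_opInv_ne`). If `M ∩ ran Q = 0`, then `ran K ⊆ M` and injectivity of `K`
separate the domains of `B` and `B*` (`domain_opInv_inf_eq_bot`).

Uniqueness of the square root (`eq_of_mul_self_eq`) uses Cayley transforms: the difference `D` of
two roots satisfies `D = C'ⁿ D Cⁿ` with contractions `C'`, `C`, and `Cⁿ → 0` strongly. Resolvent
continuity holds because `(T⁻¹ - l)⁻¹ = T (1 - l T)⁻¹` depends continuously on `T`. -/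

theorem mem_graph_opInv {T : H →L[ℂ] H} (hT : Function.Injective T) {x y : H} :
    (x, y) ∈ (opInv T).graph ↔ T y = x := by
  have hk : ((T : H →ₗ[ℂ] H).toPMap ⊤).toFun.ker = ⊥ := by
    rw [LinearMap.ker_eq_bot]
    intro a b hab
    exact Subtype.ext (hT hab)
  rw [opInv, LinearPMap.inverse_graph hk]
  constructor
  · rintro ⟨⟨a, b⟩, hab, h⟩
    obtain ⟨u, rfl, hu⟩ := (LinearPMap.mem_graph_iff _).1 hab
    simp only [LinearEquiv.coe_coe, LinearEquiv.prodComm_apply, Prod.swap_prod_mk,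
      Prod.mk.injEq] at h
    rw [← h.1, ← h.2]
    exact hu
  · rintro rfl
    exact ⟨(y, T y), (LinearPMap.mem_graph_iff _).2 ⟨⟨y, trivial⟩, rfl, rfl⟩, rfl⟩

theorem mem_domain_opInv {T : H →L[ℂ] H} (hT : Function.Injective T) {x : H} :
    x ∈ (opInv T).domain ↔ ∃ y, T y = x := by
  simp only [LinearPMap.mem_domain_iff, mem_graph_opInv hT]

theorem coe_domain_opInv {T : H →L[ℂ] H} (hT : Function.Injective T) :
    ((opInv T).domain : Set H) = Set.range T :=
  Set.ext fun _ => mem_domain_opInv hT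

theorem apply_opInv {T : H →L[ℂ] H} (hT : Function.Injective T) (u : (opInv T).domain) :
    T (opInv T u) = u :=
  (mem_graph_opInv hT).1 ((opInv T).mem_graph u)

theorem exists_opInv_apply_eq {T : H →L[ℂ] H} (hT : Function.Injective T) (y : H) :
    ∃ u : (opInv T).domain, (u : H) = T y ∧ opInv T u = y :=
  (LinearPMap.mem_graph_iff _).1 ((mem_graph_opInv hT).2 rfl)

theorem isResolventAt_opInv {T : H →L[ℂ] H} (hT : Function.Injective T) {l : ℂ}
    (h : IsUnit (1 - l • T)) :
    IsResolventAt (opInv T) l (T * Ring.inverse (1 - l • T)) where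
  right_inv y := by
    obtain ⟨u, hu, hu'⟩ := exists_opInv_apply_eq hT (Ring.inverse (1 - l • T) y)
    refine ⟨u, hu, ?_⟩
    have := congrArg (fun A : H →L[ℂ] H => A y) (Ring.mul_inverse_cancel _ h)
    rw [hu, hu']
    simpa using this
  left_inv u := by
    have hu := apply_opInv hT u
    have h2 : (1 - l • T) (opInv T u) = opInv T u - l • (u : H) := by
      simp [hu]
    rw [← h2]
    change T ((Ring.inverse (1 - l • T) * (1 - l • T)) (opInv T u)) = u
    rw [Ring.inverse_mul_cancel _ h]
    exact hu

/-- The resolvent identities read `T (1 + l R) = R` and `R (1 - l T) = T`, which make `1 + l R` a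
two-sided inverse of `1 - l T`. -/
theorem isUnit_of_isResolventAt_opInv {T : H →L[ℂ] H} (hT : Function.Injective T) {l : ℂ}
    {R : H →L[ℂ] H} (h : IsResolventAt (opInv T) l R) :
    IsUnit (1 - l • T) ∧ R = T * Ring.inverse (1 - l • T) := by
  have h1 : T * (1 + l • R) = R := by
    ext y
    obtain ⟨u, hu, hu'⟩ := h.right_inv y
    have hT' := apply_opInv hT u
    rw [sub_eq_iff_eq_add, hu] at hu'
    rw [hu', hu] at hT'
    simpa using hT'
  have h2 : R * (1 - l • T) = T := by
    ext w
    obtain ⟨u, hu, hu'⟩ := exists_opInv_apply_eq hT w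
    have := h.left_inv u
    rw [hu, hu'] at this
    simpa using this
  have h3 : (1 - l • T) * (1 + l • R) = 1 := by
    rw [sub_mul, smul_mul_assoc, h1]; simp
  have h4 : (1 + l • R) * (1 - l • T) = 1 := by
    rw [add_mul, smul_mul_assoc, h2]; simp
  have hU : IsUnit (1 - l • T) := ⟨⟨_, _, h3, h4⟩, rfl⟩
  refine ⟨hU, ?_⟩
  calc R = R * ((1 - l • T) * Ring.inverse (1 - l • T)) := by
        rw [Ring.mul_inverse_cancel _ hU, mul_one]
    _ = T * Ring.inverse (1 - l • T) := by rw [← mul_assoc, h2]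

/-- Inverses of a norm continuous family of injective operators form a norm-resolvent continuous
family. -/
theorem normResolventContinuousOn_opInv [CompleteSpace H] {T : ℝ → H →L[ℂ] H} {s : Set ℝ}
    (hT : ∀ t ∈ s, Function.Injective (T t)) (hc : Continuous T) :
    NormResolventContinuousOn (fun t => opInv (T t)) s := by
  intro t₀ ht₀
  -- The point `0` always lies in the resolvent set, with resolvent `T t₀`.
  refine ⟨⟨0, T t₀ * Ring.inverse (1 - (0 : ℂ) • T t₀),
    isResolventAt_opInv (hT t₀ ht₀) (by simp)⟩, fun l R₀ hR => ?_⟩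
  obtain ⟨hU, rfl⟩ := isUnit_of_isResolventAt_opInv (hT t₀ ht₀) hR
  have hc' : Continuous fun t => 1 - l • T t := by fun_prop
  refine ⟨fun t => T t * Ring.inverse (1 - l • T t), ?_, ?_⟩
  · have h1 : ∀ᶠ t in 𝓝[s] t₀, IsUnit (1 - l • T t) :=
      (hc'.continuousAt.eventually (Units.isOpen.mem_nhds hU)).filter_mono nhdsWithin_le_nhds
    filter_upwards [h1, self_mem_nhdsWithin] with t h1 ht
    exact isResolventAt_opInv (hT t ht) h1
  · refine Tendsto.mono_left ?_ nhdsWithin_le_nhds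
    refine (hc.tendsto t₀).mul ?_
    obtain ⟨u, hu⟩ := hU
    have h2 := NormedRing.inverse_continuousAt u
    rw [hu] at h2
    exact h2.tendsto.comp (hc'.tendsto t₀)

theorem injective_star [CompleteSpace H] {T : H →L[ℂ] H} (hd : DenseRange T) :
    Function.Injective (star T : H →L[ℂ] H) := by
  refine (injective_iff_map_eq_zero _).2 fun y hy => ?_
  refine hd.eq_zero_of_inner_right ℂ fun x => ?_
  rw [← ContinuousLinearMap.adjoint_inner_right, ← ContinuousLinearMap.star_eq_adjoint, hy,
    inner_zero_right]

theorem denseRange_of_injective_star [CompleteSpace H] {T : H →L[ℂ] H}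
    (h : Function.Injective (star T : H →L[ℂ] H)) : DenseRange T := by
  have h1 := ContinuousLinearMap.orthogonal_range T
  rw [← ContinuousLinearMap.star_eq_adjoint, LinearMap.ker_eq_bot.mpr h] at h1
  have h2 := (Submodule.dense_iff_topologicalClosure_eq_top).mpr
    ((Submodule.topologicalClosure_eq_top_iff).mpr h1)
  exact h2

theorem adjoint_opInv [CompleteSpace H] {T : H →L[ℂ] H} (hT : Function.Injective T)
    (hd : DenseRange T) : (opInv T)† = opInv (star T) := by
  have hdom : Dense ((opInv T).domain : Set H) := by
    rw [coe_domain_opInv hT]; exact hd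
  refine LinearPMap.eq_of_eq_graph ?_
  ext ⟨x, y⟩
  rw [LinearPMap.adjoint_graph_eq_graph_adjoint hdom, Submodule.mem_adjoint_iff,
    mem_graph_opInv (injective_star hd)]
  simp only [mem_graph_opInv hT]
  constructor
  · intro h
    refine (ext_inner_left ℂ fun w => ?_).symm
    rw [ContinuousLinearMap.star_eq_adjoint, ContinuousLinearMap.adjoint_inner_right]
    exact sub_eq_zero.1 (h _ w rfl)
  · rintro rfl _ b rfl
    rw [ContinuousLinearMap.star_eq_adjoint, ContinuousLinearMap.adjoint_inner_right, sub_self]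

/-! ### Bounded accretive operators -/

/-- Lax–Milgram: the form of `1 + T` is coercive with constant `1`. -/
theorem isUnit_one_add [CompleteSpace H] {T : H →L[ℂ] H} (hT : ∀ x, 0 ≤ (⟪x, T x⟫_ℂ).re) :
    IsUnit (1 + T) := by
  refine ContinuousLinearMap.isUnit_of_forall_le_norm_inner_map _ one_pos fun x => ?_
  have h1 : (⟪(1 + T) x, x⟫_ℂ).re = ‖x‖ ^ 2 + (⟪x, T x⟫_ℂ).re := by
    have h2 : (⟪T x, x⟫_ℂ).re = (⟪x, T x⟫_ℂ).re := inner_re_symm (𝕜 := ℂ) (T x) x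
    have h3 : (⟪x, x⟫_ℂ).re = ‖x‖ ^ 2 := inner_self_eq_norm_sq (𝕜 := ℂ) x
    rw [add_apply, inner_add_left, Complex.add_re, h2, one_apply_eq_self, h3]
  have h4 := Complex.re_le_norm ⟪(1 + T) x, x⟫_ℂ
  have := hT x
  simp only [NNReal.coe_one, mul_one]
  linarith

theorem isMAccretive_opInv [CompleteSpace H] {T : H →L[ℂ] H} (hT : Function.Injective T)
    (hd : DenseRange T) (hacc : ∀ x, 0 ≤ (⟪x, T x⟫_ℂ).re) : IsMAccretive (opInv T) where
  accretive u := by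
    have h := hacc (opInv T u)
    rw [apply_opInv hT] at h
    exact h.trans_eq (inner_re_symm (𝕜 := ℂ) _ _)
  dense_domain := by
    rw [coe_domain_opInv hT]; exact hd
  surjective := by
    refine ⟨-1, by simp, fun y => ?_⟩
    obtain ⟨w, hw⟩ :=
      (ContinuousLinearMap.isUnit_iff_bijective.1 (isUnit_one_add hacc)).2 y
    obtain ⟨u, hu, hu'⟩ := exists_opInv_apply_eq hT w
    refine ⟨u, ?_⟩
    rw [hu, hu', ← hw]
    simp

theorem isMAccretiveSqrt_opInv [CompleteSpace H] {R : H →L[ℂ] H} (hR : Function.Injective R)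
    (hd : DenseRange R) (hacc : ∀ x, 0 ≤ (⟪x, R x⟫_ℂ).re) :
    IsMAccretiveSqrt (opInv (R * R)) (opInv R) where
  isMAccretive := isMAccretive_opInv hR hd hacc
  mem_graph_iff x y := by
    have h : Function.Injective (R * R : H →L[ℂ] H) := hR.comp hR
    rw [mem_graph_opInv h]
    simp only [mem_graph_opInv hR]
    exact ⟨fun h => ⟨R y, h, rfl⟩, by rintro ⟨z, h1, rfl⟩; exact h1⟩

/-- An everywhere defined accretive operator is bounded. -/
theorem continuous_of_accretive [CompleteSpace H] (G : H →ₗ[ℂ] H)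
    (hG : ∀ x, 0 ≤ (⟪x, G x⟫_ℂ).re) : Continuous G := by
  refine LinearMap.continuous_of_seq_closed_graph _ fun u x y hu hGu => ?_
  -- Closed graph theorem: accretivity at `u n - x + w` passes to the limit.
  have key : ∀ w, 0 ≤ (⟪w, y - G x⟫_ℂ).re + (⟪w, G w⟫_ℂ).re := by
    intro w
    have h0 : Tendsto (fun n => (⟪u n - x + w, G (u n - x + w)⟫_ℂ).re) atTop
        (𝓝 (⟪x - x + w, y - G x + G w⟫_ℂ).re) := by
      have h1 : Tendsto (fun n => u n - x + w) atTop (𝓝 (x - x + w)) :=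
        (hu.sub_const x).add_const w
      have h2 : Tendsto (fun n => G (u n - x + w)) atTop (𝓝 (y - G x + G w)) := by
        simp only [map_add, map_sub]
        exact (hGu.sub_const _).add_const _
      exact (Complex.continuous_re.tendsto _).comp (h1.inner h2)
    have h3 := ge_of_tendsto' h0 fun n => hG _
    rwa [sub_self, zero_add, inner_add_right, Complex.add_re] at h3
  set v := y - G x with hv
  set b := (⟪v, G v⟫_ℂ).re with hb
  have h4 : ∀ s : ℝ, 0 < s → ‖v‖ ^ 2 ≤ s * b := by
    intro s hs
    -- The first term is `-s ‖v‖²` and the second only `s² b`, so letting `s → 0⁺` forces `v = 0`.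
    have h5 := key ((-s : ℂ) • v)
    have h6 : (⟪v, v⟫_ℂ).re = ‖v‖ ^ 2 := inner_self_eq_norm_sq (𝕜 := ℂ) v
    have h7 : (⟪(-s : ℂ) • v, v⟫_ℂ).re = -s * ‖v‖ ^ 2 := by
      rw [inner_smul_left, ← h6]
      simp
    have h8 : (⟪(-s : ℂ) • v, G ((-s : ℂ) • v)⟫_ℂ).re = s ^ 2 * b := by
      rw [map_smul, inner_smul_left, inner_smul_right, hb]
      simp
      ring
    rw [h7, h8] at h5
    have : 0 ≤ s * (s * b - ‖v‖ ^ 2) := by nlinarith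
    linarith [nonneg_of_mul_nonneg_right this hs]
  have h9 : ‖v‖ ^ 2 ≤ 0 := by
    have h10 : Tendsto (fun s : ℝ => s * b) (𝓝[>] 0) (𝓝 (0 * b)) :=
      ((continuous_id.mul continuous_const).tendsto 0).mono_left nhdsWithin_le_nhds
    rw [zero_mul] at h10
    exact ge_of_tendsto h10 (eventually_mem_nhdsWithin.mono fun s hs => h4 s hs)
  have h11 : v = 0 := by
    rw [← norm_eq_zero]
    exact pow_eq_zero_iff two_ne_zero |>.1 (le_antisymm h9 (sq_nonneg _))
  exact sub_eq_zero.1 h11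

/-- Since `S ∘ S = T⁻¹` is a bijection onto `H`, so is `S`; its inverse is everywhere defined and
accretive, hence bounded. This turns uniqueness of unbounded roots into a question about bounded
ones. -/
theorem exists_eq_opInv_of_isMAccretiveSqrt [CompleteSpace H] {T : H →L[ℂ] H}
    (hT : Function.Injective T) {S : H →ₗ.[ℂ] H} (hS : IsMAccretiveSqrt (opInv T) S) :
    ∃ R : H →L[ℂ] H, Function.Injective R ∧ R * R = T ∧ (∀ x, 0 ≤ (⟪x, R x⟫_ℂ).re) ∧
      S = opInv R := by
  have hsurj : ∀ y, ∃ x, (x, y) ∈ S.graph := fun y => by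
    obtain ⟨z, _, hz⟩ := (hS.mem_graph_iff (T y) y).1 ((mem_graph_opInv hT).2 rfl)
    exact ⟨z, hz⟩
  have hinj : ∀ x, (x, (0 : H)) ∈ S.graph → x = 0 := fun x hx => by
    have := (hS.mem_graph_iff x 0).2 ⟨0, hx, S.graph.zero_mem⟩
    rw [mem_graph_opInv hT, map_zero] at this
    exact this.symm
  choose g hg using hsurj
  have hg' : ∀ {x y}, (x, y) ∈ S.graph → g y = x := fun {x y} h => by
    have h1 := S.graph.sub_mem (hg y) h
    rw [Prod.mk_sub_mk, sub_self] at h1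
    exact sub_eq_zero.1 (hinj _ h1)
  let G : H →ₗ[ℂ] H :=
    { toFun := g
      map_add' := fun a b => hg' (S.graph.add_mem (hg a) (hg b))
      map_smul' := fun c a => hg' (S.graph.smul_mem c (hg a)) }
  have hG : ∀ x, 0 ≤ (⟪x, G x⟫_ℂ).re := fun x => by
    obtain ⟨u, hu, hu'⟩ := (LinearPMap.mem_graph_iff _).1 (hg x)
    have h := hS.isMAccretive.accretive u
    simp only at hu hu'
    rw [hu, hu'] at h
    exact h.trans_eq (inner_re_symm (𝕜 := ℂ) _ _)
  let R : H →L[ℂ] H := ⟨G, continuous_of_accretive G hG⟩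
  have hRinj : Function.Injective R := by
    refine (injective_iff_map_eq_zero _).2 fun y hy => ?_
    have h1 := hg y
    have h2 : g y = 0 := hy
    rw [h2] at h1
    exact S.graph_fst_eq_zero_snd h1 rfl
  refine ⟨R, hRinj, ?_, hG, ?_⟩
  · ext y
    obtain ⟨z, h1, h2⟩ := (hS.mem_graph_iff (T y) y).1 ((mem_graph_opInv hT).2 rfl)
    change g (g y) = T y
    rw [hg' h2, hg' h1]
  · refine LinearPMap.eq_of_eq_graph ?_
    ext ⟨x, y⟩
    rw [mem_graph_opInv hRinj]
    refine ⟨fun h => hg' h, fun h => ?_⟩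
    have h1 := hg y
    have h2 : g y = x := h
    rwa [h2] at h1

/-! ### Cayley transforms and uniqueness of accretive square roots -/

/-- The Cayley transform `(1 - R) (1 + R)⁻¹`. -/
def cayley (R : H →L[ℂ] H) : H →L[ℂ] H :=
  (1 - R) * Ring.inverse (1 + R)

theorem norm_one_add_sq_sub (R : H →L[ℂ] H) (w : H) :
    ‖(1 + R) w‖ ^ 2 - ‖(1 - R) w‖ ^ 2 = 4 * (⟪w, R w⟫_ℂ).re := by
  have h1 := norm_add_sq (𝕜 := ℂ) w (R w)
  have h2 := norm_sub_sq (𝕜 := ℂ) w (R w)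
  simp only [add_apply, sub_apply, one_apply_eq_self]
  rw [h1, h2, RCLike.re_to_complex]
  ring

theorem norm_sq_sub_norm_cayley_sq [CompleteSpace H] {R : H →L[ℂ] H}
    (hR : ∀ x, 0 ≤ (⟪x, R x⟫_ℂ).re) (x : H) :
    ‖x‖ ^ 2 - ‖cayley R x‖ ^ 2 =
      4 * (⟪Ring.inverse (1 + R) x, R (Ring.inverse (1 + R) x)⟫_ℂ).re := by
  rw [← norm_one_add_sq_sub]
  have h : (1 + R) (Ring.inverse (1 + R) x) = x :=
    congrArg (fun A : H →L[ℂ] H => A x) (Ring.mul_inverse_cancel _ (isUnit_one_add hR))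
  rw [h]
  rfl

theorem norm_cayley_apply_le [CompleteSpace H] {R : H →L[ℂ] H}
    (hR : ∀ x, 0 ≤ (⟪x, R x⟫_ℂ).re) (x : H) : ‖cayley R x‖ ≤ ‖x‖ := by
  have h := norm_sq_sub_norm_cayley_sq hR x
  have h2 := hR (Ring.inverse (1 + R) x)
  exact le_of_sq_le_sq (by linarith) (norm_nonneg _)

theorem norm_cayley_pow_apply_le [CompleteSpace H] {R : H →L[ℂ] H}
    (hR : ∀ x, 0 ≤ (⟪x, R x⟫_ℂ).re) (n : ℕ) (x : H) : ‖(cayley R ^ n) x‖ ≤ ‖x‖ := by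
  induction n with
  | zero => simp
  | succ n ih =>
    rw [pow_succ']
    exact (norm_cayley_apply_le hR _).trans ih

theorem commute_inverse_one_add (R : H →L[ℂ] H) : Commute R (Ring.inverse (1 + R)) := by
  have h : Commute R (1 + R) := (Commute.one_right R).add_right (Commute.refl R)
  by_cases hu : IsUnit (1 + R)
  · obtain ⟨u, hu⟩ := hu
    rw [← hu] at h ⊢
    rw [Ring.inverse_unit]
    exact h.units_inv_right
  -- Here `Ring.inverse` takes its default value `0`, so no invertibility hypothesis is needed.
  · rw [Ring.inverse_non_unit _ hu]
    exact Commute.zero_right R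

theorem commute_cayley (R : H →L[ℂ] H) : Commute R (cayley R) :=
  ((Commute.one_right R).sub_right (Commute.refl R)).mul_right (commute_inverse_one_add R)

theorem commute_inverse_cayley (R : H →L[ℂ] H) : Commute (Ring.inverse (1 + R)) (cayley R) :=
  ((Commute.one_right _).sub_right (commute_inverse_one_add R).symm).mul_right (Commute.refl _)

/-- A positive operator is of the form `S * S` with `S` selfadjoint. -/
theorem exists_sq_eq_of_isPositive [CompleteSpace H] {Q : H →L[ℂ] H} (hQ : Q.IsPositive) :
    ∃ S : H →L[ℂ] H, S * S = Q ∧ ∀ x, (⟪x, Q x⟫_ℂ).re = ‖S x‖ ^ 2 := by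
  have h0 : 0 ≤ Q := (ContinuousLinearMap.nonneg_iff_isPositive Q).2 hQ
  have hS : star (CFC.sqrt Q) = CFC.sqrt Q :=
    (IsSelfAdjoint.of_nonneg (CFC.sqrt_nonneg Q)).star_eq
  have hSS : CFC.sqrt Q * CFC.sqrt Q = Q := CFC.sqrt_mul_sqrt_self _ h0
  refine ⟨_, hSS, fun x => ?_⟩
  have h1 : ⟪x, Q x⟫_ℂ = ⟪CFC.sqrt Q x, CFC.sqrt Q x⟫_ℂ := by
    conv_lhs => rw [← hSS]
    rw [← ContinuousLinearMap.adjoint_inner_right, ← ContinuousLinearMap.star_eq_adjoint, hS]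
    rfl
  rw [h1]
  exact inner_self_eq_norm_sq (𝕜 := ℂ) _

/-- If the real part of `R` is a positive operator `Q` of which `R` is a left multiple, and `R` has
dense range, then the powers of the Cayley transform of `R` tend strongly to zero. -/
theorem tendsto_cayley_pow [CompleteSpace H] {Q R C : H →L[ℂ] H} (hQ : Q.IsPositive)
    (hRC : R = C * Q) (hre : ∀ x, (⟪x, R x⟫_ℂ).re = (⟪x, Q x⟫_ℂ).re) (hd : DenseRange R) (x : H) :
    Tendsto (fun n : ℕ => (cayley R ^ n) x) atTop (𝓝 0) := by
  obtain ⟨S, hSS, hS⟩ := exists_sq_eq_of_isPositive hQ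
  have hR : ∀ x, 0 ≤ (⟪x, R x⟫_ℂ).re := fun x => by rw [hre, hS]; positivity
  set J := Ring.inverse (1 + R) with hJ
  have hJ1 : J * (1 + R) = 1 := Ring.inverse_mul_cancel _ (isUnit_one_add hR)
  have hdiff : ∀ (z : H) (n : ℕ), ‖(cayley R ^ n) z‖ ^ 2 - ‖(cayley R ^ (n + 1)) z‖ ^ 2 =
      4 * ‖S (J ((cayley R ^ n) z))‖ ^ 2 := fun z n => by
    rw [← hS, ← hre, pow_succ' (cayley R), ← norm_sq_sub_norm_cayley_sq hR]
    rfl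
  have hSz : ∀ z, Tendsto (fun n : ℕ => S (J ((cayley R ^ n) z))) atTop (𝓝 0) := fun z => by
    -- The squared norms decrease to a limit, so their consecutive differences, given by `hdiff`,
    -- tend to zero.
    have hanti : Antitone fun n : ℕ => ‖(cayley R ^ n) z‖ ^ 2 :=
      antitone_nat_of_succ_le fun n => by
        have := hdiff z n
        nlinarith [sq_nonneg ‖S (J ((cayley R ^ n) z))‖]
    have hlim := tendsto_atTop_ciInf hanti ⟨0, by rintro _ ⟨n, rfl⟩; positivity⟩
    have h1 := hlim.sub (hlim.comp (tendsto_add_atTop_nat 1))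
    simp only [Function.comp_def, hdiff, sub_self] at h1
    have h2 := (h1.div_const 4).sqrt
    simp only [mul_div_cancel_left₀ _ (four_ne_zero' ℝ), zero_div, Real.sqrt_zero,
      Real.sqrt_sq (norm_nonneg _)] at h2
    exact tendsto_zero_iff_norm_tendsto_zero.2 h2
  have hRz : ∀ z, Tendsto (fun n : ℕ => (cayley R ^ n) (R z)) atTop (𝓝 0) := fun z => by
    have h1 := ((C * S).continuous.tendsto 0).comp (hSz ((1 + R) z))
    rw [map_zero] at h1
    refine h1.congr fun n => ?_
    -- With `R = C S S`, this extends the decay in `hSz` to vectors in `ran R`; density and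
    -- contractivity do the rest.
    have hc : C * S * (S * (J * (cayley R ^ n * (1 + R)))) = cayley R ^ n * R := by
      have e1 : Commute J (cayley R ^ n) := (commute_inverse_cayley R).pow_right n
      have e2 : Commute R (cayley R ^ n) := (commute_cayley R).pow_right n
      calc C * S * (S * (J * (cayley R ^ n * (1 + R))))
          = (C * (S * S)) * ((J * cayley R ^ n) * (1 + R)) := by simp only [mul_assoc]
        _ = R * (cayley R ^ n * (J * (1 + R))) := by rw [hSS, ← hRC, e1.eq, mul_assoc]
        _ = cayley R ^ n * R := by rw [hJ1, mul_one, e2.eq]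
    exact congrArg (fun A : H →L[ℂ] H => A z) hc
  rw [Metric.tendsto_atTop]
  intro ε hε
  obtain ⟨z, hz⟩ := hd.exists_dist_lt x (half_pos hε)
  obtain ⟨N, hN⟩ := Metric.tendsto_atTop.1 (hRz z) (ε / 2) (half_pos hε)
  refine ⟨N, fun n hn => ?_⟩
  have h1 := hN n hn
  have h2 := norm_cayley_pow_apply_le hR n (x - R z)
  rw [dist_eq_norm] at hz
  rw [dist_zero_right] at h1 ⊢
  calc ‖(cayley R ^ n) x‖ = ‖(cayley R ^ n) (x - R z) + (cayley R ^ n) (R z)‖ := by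
        rw [← map_add, sub_add_cancel]
    _ ≤ ‖(cayley R ^ n) (x - R z)‖ + ‖(cayley R ^ n) (R z)‖ := norm_add_le _ _
    _ < ε := by linarith

theorem eq_of_mul_self_eq [CompleteSpace H] {Q R C R' : H →L[ℂ] H} (hQ : Q.IsPositive)
    (hRC : R = C * Q) (hre : ∀ x, (⟪x, R x⟫_ℂ).re = (⟪x, Q x⟫_ℂ).re) (hd : DenseRange R)
    (hR' : ∀ x, 0 ≤ (⟪x, R' x⟫_ℂ).re) (h : R' * R' = R * R) : R' = R := by
  have hR : ∀ x, 0 ≤ (⟪x, R x⟫_ℂ).re := fun x => by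
    rw [hre]; exact hQ.re_inner_nonneg_right x
  set D := R' - R with hD
  -- The two sides differ by `-2 (R' D + D R)`, and `R' D + D R = R'² - R² = 0`.
  have h1 : (1 - R') * D * (1 - R) = (1 + R') * D * (1 + R) := by
    have h2 : R' * D + D * R = 0 := by
      rw [hD, mul_sub, sub_mul, h]; abel
    have h3 : (1 - R') * D * (1 - R) - (1 + R') * D * (1 + R) = -2 * (R' * D + D * R) := by
      noncomm_ring
    rw [h2, mul_zero] at h3
    exact sub_eq_zero.1 h3
  have h2 : D = cayley R' * D * cayley R := by
    have e1 : cayley R' = Ring.inverse (1 + R') * (1 - R') :=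
      ((Commute.one_left _).sub_left (commute_inverse_one_add R')).eq
    calc D = (Ring.inverse (1 + R') * (1 + R')) * D * ((1 + R) * Ring.inverse (1 + R)) := by
          rw [Ring.inverse_mul_cancel _ (isUnit_one_add hR'),
            Ring.mul_inverse_cancel _ (isUnit_one_add hR), one_mul, mul_one]
      _ = Ring.inverse (1 + R') * ((1 + R') * D * (1 + R)) * Ring.inverse (1 + R) := by
          simp only [mul_assoc]
      _ = cayley R' * D * cayley R := by
          rw [← h1, e1, cayley]; simp only [mul_assoc]
  have h3 : ∀ n : ℕ, D = cayley R' ^ n * D * cayley R ^ n := fun n => by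
    induction n with
    | zero => simp
    | succ n ih =>
      rw [pow_succ, pow_succ' (cayley R)]
      calc D = cayley R' ^ n * (cayley R' * D * cayley R) * cayley R ^ n := by rw [← h2, ← ih]
        _ = _ := by simp only [mul_assoc]
  refine sub_eq_zero.1 (ContinuousLinearMap.ext fun x => ?_)
  change D x = 0
  have h4 : Tendsto (fun n : ℕ => ‖D ((cayley R ^ n) x)‖) atTop (𝓝 0) := by
    have := ((D.continuous.tendsto 0).comp (tendsto_cayley_pow hQ hRC hre hd x)).norm
    simpa using this
  have h5 : ‖D x‖ ≤ 0 := ge_of_tendsto' h4 fun n => by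
    conv_lhs => rw [h3 n]
    exact norm_cayley_pow_apply_le hR' n _
  exact norm_le_zero_iff.1 h5

theorem isMAccretiveSqrt_iff_eq_opInv [CompleteSpace H] {Q R C : H →L[ℂ] H} (hQ : Q.IsPositive)
    (hRC : R = C * Q) (hre : ∀ x, (⟪x, R x⟫_ℂ).re = (⟪x, Q x⟫_ℂ).re)
    (hinj : Function.Injective R) (hd : DenseRange R) (S : H →ₗ.[ℂ] H) :
    IsMAccretiveSqrt (opInv (R * R)) S ↔ S = opInv R := by
  constructor
  · intro h
    obtain ⟨R', _, h1, h2, rfl⟩ := exists_eq_opInv_of_isMAccretiveSqrt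
      (show Function.Injective (R * R : H →L[ℂ] H) from hinj.comp hinj) h
    rw [eq_of_mul_self_eq hQ hRC hre hd h2 h1]
  · rintro rfl
    refine isMAccretiveSqrt_opInv hinj hd fun x => ?_
    rw [hre]; exact hQ.re_inner_nonneg_right x

theorem mSqrt_eq {B S : H →ₗ.[ℂ] H} (h : ∀ S', IsMAccretiveSqrt B S' ↔ S' = S) :
    mSqrt B = S :=
  (h _).1 (Classical.epsilon_spec ⟨S, (h S).2 rfl⟩)

/-! ### Operators `Q (1 + K)` with `Q K` skew-adjoint -/

section SkewPerturbation

variable [CompleteSpace H] {Q K : H →L[ℂ] H}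

theorem mul_one_add_eq (h : Q * K = -(star K * Q)) : Q * (1 + K) = (1 - star K) * Q := by
  rw [mul_add, h, mul_one, sub_mul, one_mul, sub_eq_add_neg]

theorem star_mul_one_add (hQ : Q.IsPositive) (h : Q * K = -(star K * Q)) :
    star (Q * (1 + K)) = Q * (1 + -K) := by
  rw [mul_one_add_eq h, star_mul, star_sub, star_star, star_one, hQ.isSelfAdjoint.star_eq,
    sub_eq_add_neg]

theorem mul_neg_eq (h : Q * K = -(star K * Q)) : Q * -K = -(star (-K) * Q) := by
  rw [mul_neg, h, star_neg, neg_mul]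

theorem re_inner_mul_one_add (hQ : Q.IsPositive) (h : Q * K = -(star K * Q)) (x : H) :
    (⟪x, (Q * (1 + K)) x⟫_ℂ).re = (⟪x, Q x⟫_ℂ).re := by
  have h1 : ⟪x, (Q * K) x⟫_ℂ = -⟪(Q * K) x, x⟫_ℂ := by
    rw [← ContinuousLinearMap.adjoint_inner_right, ← ContinuousLinearMap.star_eq_adjoint, star_mul,
      hQ.isSelfAdjoint.star_eq, h]
    simp
  have h2 : (⟪(Q * K) x, x⟫_ℂ).re = (⟪x, (Q * K) x⟫_ℂ).re := inner_re_symm (𝕜 := ℂ) _ _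
  have h3 := congrArg Complex.re h1
  rw [Complex.neg_re, h2] at h3
  rw [mul_add, mul_one, add_apply, inner_add_right, Complex.add_re]
  linarith

theorem injective_mul_one_add (hQ : Q.IsPositive) (hker : Function.Injective Q)
    (h : Q * K = -(star K * Q)) : Function.Injective (Q * (1 + K) : H →L[ℂ] H) := by
  obtain ⟨S, hSS, hS⟩ := exists_sq_eq_of_isPositive hQ
  refine (injective_iff_map_eq_zero _).2 fun x hx => ?_
  have h1 := re_inner_mul_one_add hQ h x
  rw [hx, inner_zero_right, hS, Complex.zero_re] at h1
  have h2 : S x = 0 := norm_eq_zero.1 (pow_eq_zero_iff two_ne_zero |>.1 h1.symm)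
  apply hker
  rw [← hSS, map_zero]
  change S (S x) = 0
  rw [h2, map_zero]

theorem denseRange_mul_one_add (hQ : Q.IsPositive) (hker : Function.Injective Q)
    (h : Q * K = -(star K * Q)) : DenseRange (Q * (1 + K) : H →L[ℂ] H) := by
  apply denseRange_of_injective_star
  rw [star_mul_one_add hQ h]
  exact injective_mul_one_add hQ hker (mul_neg_eq h)

theorem mul_one_add_mul_self (h : Q * K = -(star K * Q)) :
    Q * (1 + K) * (1 - star K) * Q = Q * (1 + K) * (Q * (1 + K)) := by
  rw [mul_assoc, ← mul_one_add_eq h]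

/-- With `v = Q x` and `w = K* v`, the form equals `⟪v + w, v - w⟫`, whose real part is `‖v‖² -
‖w‖²`. -/
theorem re_inner_mul_self_nonneg (hQ : Q.IsPositive) (h : Q * K = -(star K * Q)) (hK : ‖K‖ ≤ 1)
    (x : H) : 0 ≤ (⟪x, (Q * (1 + K) * (Q * (1 + K))) x⟫_ℂ).re := by
  set v := Q x with hv
  set w := star K v with hw
  have h1 : ⟪x, (Q * (1 + K) * (Q * (1 + K))) x⟫_ℂ = ⟪v + w, v - w⟫_ℂ := by
    have e : Q * (1 + K) * (Q * (1 + K)) = Q * ((1 + K) * ((1 - star K) * Q)) := by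
      rw [← mul_one_add_eq h]; simp only [mul_assoc]
    have e2 : star (1 + K) = 1 + star K := by simp
    rw [e]
    change ⟪x, Q ((1 + K) (((1 - star K) * Q) x))⟫_ℂ = _
    rw [← hQ.inner_left_eq_inner_right, ← ContinuousLinearMap.adjoint_inner_left,
      ← ContinuousLinearMap.star_eq_adjoint, e2]
    rfl
  have h2 : (⟪v + w, v - w⟫_ℂ).re = ‖v‖ ^ 2 - ‖w‖ ^ 2 := by
    have e1 : (⟪w, v⟫_ℂ).re = (⟪v, w⟫_ℂ).re := inner_re_symm (𝕜 := ℂ) _ _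
    have e2 : (⟪v, v⟫_ℂ).re = ‖v‖ ^ 2 := inner_self_eq_norm_sq (𝕜 := ℂ) v
    have e3 : (⟪w, w⟫_ℂ).re = ‖w‖ ^ 2 := inner_self_eq_norm_sq (𝕜 := ℂ) w
    rw [inner_add_left, inner_sub_right, inner_sub_right]
    simp only [Complex.add_re, Complex.sub_re, e1, e2, e3]
    ring
  have h3 : ‖w‖ ≤ ‖v‖ := by
    refine ((star K).le_opNorm v).trans ?_
    rw [norm_star]
    exact mul_le_of_le_one_left (norm_nonneg _) hK
  rw [h1, h2, sub_nonneg]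
  gcongr

end SkewPerturbation

/-! ### Exponentials -/

/-- Here `b = ∑ aⁿ / (n + 1)!`. It serves to split the factor `1 - Z` off `1 - expTwist Z t`. -/
theorem exists_exp_eq_one_add_mul {A : Type*} [NormedRing A] [NormedAlgebra ℂ A] [CompleteSpace A]
    (a : A) : ∃ b, NormedSpace.exp a = 1 + a * b ∧ ∀ c, Commute c a → Commute c b := by
  have hb : Summable fun n : ℕ => ((n + 1).factorial⁻¹ : ℂ) • a ^ n := by
    refine .of_norm_bounded_eventually (Real.summable_pow_div_factorial ‖a‖) ?_
    filter_upwards [Filter.eventually_cofinite_ne 0] with n hn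
    rw [norm_smul, mul_comm, norm_inv, RCLike.norm_natCast, ← div_eq_mul_inv]
    gcongr
    · exact norm_pow_le' _ (pos_iff_ne_zero.mpr hn)
    · exact n.le_succ
  refine ⟨∑' n : ℕ, ((n + 1).factorial⁻¹ : ℂ) • a ^ n, ?_, fun c hc => ?_⟩
  · have h := (NormedSpace.expSeries_summable' (𝕂 := ℂ) a).tsum_eq_zero_add
    rw [NormedSpace.exp_eq_tsum ℂ]
    simp only [Nat.factorial_zero, Nat.cast_one, inv_one, pow_zero, one_smul] at h
    beta_reduce
    rw [h, ← hb.tsum_mul_left a]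
    simp only [mul_smul_comm, pow_succ']
  · exact Commute.tsum_right c fun n => (hc.pow_right n).smul_right _

/-- The hypothesis `‖1‖ ≤ 1`, unlike `‖1‖ = 1`, also holds for operators on the zero space. -/
theorem norm_exp_le_exp_norm {A : Type*} [NormedRing A] [NormedAlgebra ℂ A] [CompleteSpace A]
    (h1 : ‖(1 : A)‖ ≤ 1) (a : A) : ‖NormedSpace.exp a‖ ≤ Real.exp ‖a‖ := by
  rw [NormedSpace.exp_eq_tsum ℂ]
  have h := NormedSpace.expSeries_div_hasSum_exp (𝔸 := ℝ) ‖a‖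
  rw [← Real.exp_eq_exp_ℝ] at h
  refine tsum_of_norm_bounded h fun n => ?_
  rw [norm_smul, norm_inv, RCLike.norm_natCast, div_eq_inv_mul]
  gcongr
  rcases n.eq_zero_or_pos with rfl | hn
  · simpa using h1
  · exact norm_pow_le' _ hn

/-! ### Non-unitary isometries -/

section Isometry

variable [CompleteSpace H] {Z : H →L[ℂ] H}

theorem norm_le_one_of_star_mul_self (hZ : star Z * Z = 1) : ‖Z‖ ≤ 1 := by
  have h1 : ‖Z‖ * ‖Z‖ ≤ 1 := by
    rw [← CStarRing.norm_star_mul_self, hZ]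
    exact ContinuousLinearMap.norm_id_le
  nlinarith [norm_nonneg Z]

/-- Otherwise `1 - r Z` is invertible for some `r > 1`. Since `Z* (1 - r Z) = -r (1 - r⁻¹ Z*)` is
invertible by a Neumann series, `Z*` would be invertible and `Z` unitary. -/
theorem not_isUnit_one_sub (hZ : star Z * Z = 1) (hZ' : Z * star Z ≠ 1) : ¬ IsUnit (1 - Z) := by
  intro hU
  have hc : Continuous fun r : ℝ => 1 - (r : ℂ) • Z := by fun_prop
  have h1 : ∀ᶠ r : ℝ in 𝓝[>] 1, IsUnit (1 - (r : ℂ) • Z) := by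
    refine (hc.continuousAt.eventually (Units.isOpen.mem_nhds ?_)).filter_mono nhdsWithin_le_nhds
    simpa using hU
  obtain ⟨r, hr, hr1⟩ := (h1.and self_mem_nhdsWithin).exists
  have hr1 : 1 < r := hr1
  have hr0 : (r : ℂ) ≠ 0 := by
    norm_cast; positivity
  have h2 : IsUnit (1 - (r : ℂ)⁻¹ • star Z) := by
    refine isUnit_one_sub_of_norm_lt_one ?_
    rw [norm_smul, norm_star, norm_inv, Complex.norm_real, Real.norm_of_nonneg (by positivity)]
    calc r⁻¹ * ‖Z‖ ≤ r⁻¹ * 1 := by gcongr; exact norm_le_one_of_star_mul_self hZ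
      _ < 1 := by rw [mul_one]; exact inv_lt_one_of_one_lt₀ hr1
  have h3 : star Z * (1 - (r : ℂ) • Z) = (-(r : ℂ)) • (1 - (r : ℂ)⁻¹ • star Z) := by
    rw [mul_sub, mul_one, mul_smul_comm, hZ, smul_sub, smul_smul, neg_mul, mul_inv_cancel₀ hr0,
      neg_smul, neg_smul, one_smul]
    abel
  have h4 : IsUnit (star Z * (1 - (r : ℂ) • Z)) := by
    rw [h3]
    exact (h2.smul (Units.mk0 (-(r : ℂ)) (neg_ne_zero.2 hr0)))
  have h5 : IsUnit (star Z) := by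
    have := h4.mul hr.unit⁻¹.isUnit
    rwa [mul_assoc, IsUnit.mul_val_inv, mul_one] at this
  obtain ⟨u, hu⟩ := h5
  apply hZ'
  rw [← hu] at hZ ⊢
  rw [← (Units.inv_eq_of_mul_eq_one_right hZ : (↑u⁻¹ : H →L[ℂ] H) = Z), Units.inv_mul]

/-- The operator `Z exp(-t (1 - Z²))`. -/
def expTwist (Z : H →L[ℂ] H) (t : ℝ) : H →L[ℂ] H :=
  Z * NormedSpace.exp (-(t : ℂ) • (1 - Z ^ 2))

theorem continuous_expTwist (Z : H →L[ℂ] H) : Continuous (expTwist Z) := by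
  let +nondep : NormedAlgebra ℚ (H →L[ℂ] H) := .restrictScalars ℚ ℂ _
  have : Continuous fun t : ℝ => -(t : ℂ) • (1 - Z ^ 2) := by fun_prop
  exact continuous_const.mul (NormedSpace.exp_continuous.comp this)

theorem norm_expTwist_le (hZ : star Z * Z = 1) {t : ℝ} (ht : 0 ≤ t) : ‖expTwist Z t‖ ≤ 1 := by
  let +nondep : NormedAlgebra ℚ (H →L[ℂ] H) := .restrictScalars ℚ ℂ _
  have h1 : ‖(1 : H →L[ℂ] H)‖ ≤ 1 := ContinuousLinearMap.norm_id_le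
  have hn := norm_le_one_of_star_mul_self hZ
  have e1 : -(t : ℂ) • (1 - Z ^ 2) = algebraMap ℂ (H →L[ℂ] H) (-(t : ℂ)) + (t : ℂ) • Z ^ 2 := by
    rw [Algebra.algebraMap_eq_smul_one, smul_sub, neg_smul, neg_smul]; abel
  -- The scalar `e^{-t}` exactly compensates the bound `‖exp(t Z²)‖ ≤ e^t`.
  have e2 : NormedSpace.exp (-(t : ℂ) • (1 - Z ^ 2)) =
      Complex.exp (-(t : ℂ)) • NormedSpace.exp ((t : ℂ) • Z ^ 2) := by
    rw [e1, NormedSpace.exp_add_of_commute (Algebra.commutes _ _),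
      ← NormedSpace.algebraMap_exp_comm, Complex.exp_eq_exp_ℂ,
      ← Algebra.smul_def]
  have h2 : ‖NormedSpace.exp ((t : ℂ) • Z ^ 2)‖ ≤ Real.exp t := by
    refine (norm_exp_le_exp_norm h1 _).trans (Real.exp_le_exp.2 ?_)
    rw [norm_smul, Complex.norm_real, Real.norm_of_nonneg ht]
    refine mul_le_of_le_one_right ht ((norm_pow_le' _ two_pos).trans ?_)
    exact pow_le_one₀ (norm_nonneg _) hn
  have h3 : ‖NormedSpace.exp (-(t : ℂ) • (1 - Z ^ 2))‖ ≤ 1 := by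
    rw [e2, norm_smul, Complex.norm_exp]
    calc _ ≤ Real.exp (-(t : ℂ)).re * Real.exp t := by gcongr
      _ = 1 := by rw [← Real.exp_add]; simp
  refine (norm_mul_le _ _).trans ?_
  exact mul_le_one₀ hn (norm_nonneg _) h3

theorem not_isUnit_one_sub_expTwist (hZ : star Z * Z = 1) (hZ' : Z * star Z ≠ 1) (t : ℝ) :
    ¬ IsUnit (1 - expTwist Z t) := by
  obtain ⟨b, hb, hc⟩ := exists_exp_eq_one_add_mul (-(t : ℂ) • (1 - Z ^ 2))
  have hZb : Commute Z b := hc Z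
    (((Commute.one_right Z).sub_right ((Commute.refl Z).pow_right 2)).smul_right _)
  have h1 : 1 - expTwist Z t = (1 - Z) * (1 + (t : ℂ) • (Z * (1 + Z) * b)) := by
    have e : Z * ((1 - Z ^ 2) * b) = (1 - Z) * (Z * (1 + Z) * b) := by noncomm_ring
    rw [expTwist, hb, smul_mul_assoc, mul_add, mul_add, mul_one, mul_one, mul_smul_comm,
      mul_smul_comm, e, neg_smul]
    abel
  have h2 : Commute (1 - Z) (1 + (t : ℂ) • (Z * (1 + Z) * b)) := by
    have hz : Commute Z (1 + (t : ℂ) • (Z * (1 + Z) * b)) :=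
      (Commute.one_right Z).add_right ((((Commute.refl Z).mul_right
        ((Commute.one_right Z).add_right (Commute.refl Z))).mul_right hZb).smul_right _)
    exact (Commute.one_left _).sub_left hz
  rw [h1, h2.isUnit_mul_iff]
  exact fun h => not_isUnit_one_sub hZ hZ' h.1

/-- Two sign changes cancel, so `Q` intertwines `Z²` with `(Z*)²`, hence also the exponentials; only
the single factor `Z` contributes a sign. -/
theorem mul_expTwist_eq {Q : H →L[ℂ] H} (h : Q * Z = -(star Z * Q)) (t : ℝ) :
    Q * expTwist Z t = -(star (expTwist Z t) * Q) := by
  set a : H →L[ℂ] H := -(t : ℂ) • (1 - Z ^ 2) with ha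
  have hsa : star a = -(t : ℂ) • (1 - star Z ^ 2) := by
    rw [ha, star_smul, star_sub, star_pow, star_one, star_neg]
    simp
  have h2 : Q * Z ^ 2 = star Z ^ 2 * Q := by
    rw [pow_two, ← mul_assoc, h, neg_mul, mul_assoc, h, mul_neg, neg_neg, ← mul_assoc, pow_two]
  have h3 : SemiconjBy Q a (star a) := by
    rw [hsa, ha, SemiconjBy, mul_smul_comm, smul_mul_assoc, mul_sub, sub_mul, h2, mul_one, one_mul]
  have h4 : Q * NormedSpace.exp a = NormedSpace.exp (star a) * Q := by
    let +nondep : NormedAlgebra ℚ (H →L[ℂ] H) := .restrictScalars ℚ ℂ _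
    exact h3.exp_right.eq
  have h5 : Commute (star Z) (NormedSpace.exp (star a)) := by
    refine Commute.exp_right ?_
    rw [hsa]
    exact ((Commute.one_right _).sub_right ((Commute.refl _).pow_right 2)).smul_right _
  rw [expTwist, ← ha, star_mul, NormedSpace.star_exp, ← h5.eq, ← mul_assoc, h, neg_mul, mul_assoc,
    h4, mul_assoc]

theorem injective_expTwist (hZ : Function.Injective Z) (t : ℝ) :
    Function.Injective (expTwist Z t) := by
  refine hZ.comp (ContinuousLinearMap.isUnit_iff_bijective.1 ?_).1
  let +nondep : NormedAlgebra ℚ (H →L[ℂ] H) := .restrictScalars ℚ ℂ _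
  exact NormedSpace.isUnit_exp _

end Isometry

/-! ### The operator `Z₀` -/

section ZZero

variable [CompleteSpace H] {Q : H →L[ℂ] H} (hQ : Q.IsPositive) (hker : Function.Injective Q)
  (M : Submodule ℂ H) [M.HasOrthogonalProjection]

theorem star_sqrtQPQ : star (sqrtQPQ Q M) = sqrtQPQ Q M :=
  (IsSelfAdjoint.of_nonneg (CFC.sqrt_nonneg (Q * M.starProjection * Q))).star_eq

variable {M} in
theorem sqrtQPQ_mul_self (hQ : Q.IsPositive) :
    sqrtQPQ Q M * sqrtQPQ Q M = Q * M.starProjection * Q := by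
  refine CFC.sqrt_mul_sqrt_self _ ?_
  have h := star_left_conjugate_nonneg
    (show (0 : H →L[ℂ] H) ≤ M.starProjection from
      (isStarProjection_starProjection (U := M)).nonneg) Q
  rwa [hQ.isSelfAdjoint.star_eq] at h

theorem mul_Z₀ : Q * Z₀ hQ hker M = Complex.I • sqrtQPQ Q M :=
  ContinuousLinearMap.ext fun x => (exists_Z₀ hQ hker M).choose_spec x

theorem star_Z₀_mul : star (Z₀ hQ hker M) * Q = -(Complex.I • sqrtQPQ Q M) := by
  have h := congrArg star (mul_Z₀ hQ hker M)
  rw [star_mul, hQ.isSelfAdjoint.star_eq, star_smul, star_sqrtQPQ] at h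
  rw [h, ← neg_smul]
  simp

theorem mul_Z₀_eq : Q * Z₀ hQ hker M = -(star (Z₀ hQ hker M) * Q) := by
  rw [star_Z₀_mul, neg_neg, mul_Z₀]

theorem Z₀_mul_star : Z₀ hQ hker M * star (Z₀ hQ hker M) = M.starProjection := by
  set Z := Z₀ hQ hker M with hZ
  have h1 : Q * (Z * star Z) * Q = Q * M.starProjection * Q := by
    calc Q * (Z * star Z) * Q = (Q * Z) * (star Z * Q) := by simp only [mul_assoc]
      _ = Q * M.starProjection * Q := by
        rw [hZ, mul_Z₀, star_Z₀_mul, mul_neg, smul_mul_smul_comm, Complex.I_mul_I, neg_one_smul,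
          neg_neg, sqrtQPQ_mul_self hQ]
  have hd : DenseRange Q := denseRange_of_injective_star (by rwa [hQ.isSelfAdjoint.star_eq])
  have h2 : (Z * star Z : H →L[ℂ] H) ∘ Q = M.starProjection ∘ Q :=
    funext fun x => hker (congrArg (fun A : H →L[ℂ] H => A x) h1)
  exact DFunLike.coe_injective
    (hd.equalizer (Z * star Z).continuous M.starProjection.continuous h2)

theorem starProjection_mul_Z₀ : M.starProjection * Z₀ hQ hker M = Z₀ hQ hker M := by
  have hP := isStarProjection_starProjection (U := M)
  set P := M.starProjection
  set Z := Z₀ hQ hker M with hZ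
  -- The product is `(1 - P) P (1 - P)` because `Z Z* = P`; the C*-identity then gives `(1 - P) Z =
  -- 0`.
  have h : ((1 - P) * Z) * star ((1 - P) * Z) = 0 := by
    rw [star_mul, star_sub, star_one, hP.isSelfAdjoint.star_eq, mul_assoc, ← mul_assoc Z, hZ,
      Z₀_mul_star]
    change (1 - P) * (P * (1 - P)) = 0
    rw [mul_sub P, mul_one, hP.isIdempotentElem.eq, sub_self, mul_zero]
  rw [CStarRing.mul_star_self_eq_zero_iff, sub_mul, one_mul, sub_eq_zero] at h
  exact h.symm

theorem injective_Z₀ (hMQ : Mᗮ ⊓ LinearMap.range (Q : H →ₗ[ℂ] H) = ⊥) :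
    Function.Injective (Z₀ hQ hker M) := by
  refine (injective_iff_map_eq_zero _).2 fun x hx => ?_
  have h1 : Complex.I • sqrtQPQ Q M x = 0 := by
    have := congrArg (fun A : H →L[ℂ] H => A x) (mul_Z₀ hQ hker M)
    rw [mul_apply_eq_comp, hx, map_zero] at this
    exact this.symm
  have h2 : sqrtQPQ Q M x = 0 := (smul_eq_zero.1 h1).resolve_left Complex.I_ne_zero
  have h3 : Q (M.starProjection (Q x)) = 0 := by
    have := congrArg (fun A : H →L[ℂ] H => A x) (sqrtQPQ_mul_self (M := M) hQ)
    change sqrtQPQ Q M (sqrtQPQ Q M x) = Q (M.starProjection (Q x)) at this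
    rw [← this, h2, map_zero]
  have h4 : M.starProjection (Q x) = 0 := hker (h3.trans (map_zero Q).symm)
  have h5 : Q x ∈ Mᗮ ⊓ LinearMap.range (Q : H →ₗ[ℂ] H) :=
    ⟨(Submodule.starProjection_apply_eq_zero_iff M).1 h4, x, rfl⟩
  rw [hMQ, Submodule.mem_bot] at h5
  exact hker (h5.trans (map_zero Q).symm)

theorem star_Z₀_mul_self (hMQ : Mᗮ ⊓ LinearMap.range (Q : H →ₗ[ℂ] H) = ⊥) :
    star (Z₀ hQ hker M) * Z₀ hQ hker M = 1 := by
  refine ContinuousLinearMap.ext fun x => injective_Z₀ hQ hker M hMQ ?_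
  have h : Z₀ hQ hker M * (star (Z₀ hQ hker M) * Z₀ hQ hker M) = Z₀ hQ hker M := by
    rw [← mul_assoc, Z₀_mul_star, starProjection_mul_Z₀]
  exact congrArg (fun A : H →L[ℂ] H => A x) h

theorem Z₀_mul_star_ne_one (hM : M ≠ ⊤) : Z₀ hQ hker M * star (Z₀ hQ hker M) ≠ 1 := by
  rw [Z₀_mul_star]
  intro h
  refine hM (eq_top_iff.2 fun x _ => ?_)
  rw [← Submodule.starProjection_eq_self_iff, h]
  rfl

end ZZero

/-! ### The inverse of `Q (1 + K) (1 - K*) Q` -/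

section Final

variable [CompleteSpace H] {Q K : H →L[ℂ] H}

theorem mSqrt_opInv_mul_self (hQ : Q.IsPositive) (hker : Function.Injective Q)
    (h : Q * K = -(star K * Q)) :
    (∃! S, IsMAccretiveSqrt (opInv (Q * (1 + K) * (Q * (1 + K)))) S) ∧
      mSqrt (opInv (Q * (1 + K) * (Q * (1 + K)))) = opInv (Q * (1 + K)) := by
  have key := isMAccretiveSqrt_iff_eq_opInv hQ (mul_one_add_eq h) (re_inner_mul_one_add hQ h)
    (injective_mul_one_add hQ hker h) (denseRange_mul_one_add hQ hker h)
  exact ⟨⟨_, (key _).2 rfl, fun S hS => (key S).1 hS⟩, mSqrt_eq key⟩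

theorem injective_mul_one_add_mul_self (hQ : Q.IsPositive) (hker : Function.Injective Q)
    (h : Q * K = -(star K * Q)) :
    Function.Injective (Q * (1 + K) * (Q * (1 + K)) : H →L[ℂ] H) :=
  (injective_mul_one_add hQ hker h).comp (injective_mul_one_add hQ hker h)

theorem denseRange_mul_one_add_mul_self (hQ : Q.IsPositive) (hker : Function.Injective Q)
    (h : Q * K = -(star K * Q)) : DenseRange (Q * (1 + K) * (Q * (1 + K)) : H →L[ℂ] H) :=
  (denseRange_mul_one_add hQ hker h).comp (denseRange_mul_one_add hQ hker h)
    (Q * (1 + K)).continuous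

theorem adjoint_opInv_mul_one_add_mul_self (hQ : Q.IsPositive) (hker : Function.Injective Q)
    (h : Q * K = -(star K * Q)) :
    (opInv (Q * (1 + K) * (Q * (1 + K))))† = opInv (Q * (1 + -K) * (Q * (1 + -K))) := by
  rw [adjoint_opInv (injective_mul_one_add_mul_self hQ hker h)
    (denseRange_mul_one_add_mul_self hQ hker h), star_mul, star_mul_one_add hQ h]

theorem domain_opInv_ne (hQ : Q.IsPositive) (hker : Function.Injective Q)
    (h : Q * K = -(star K * Q)) (hU : ¬ IsUnit (1 - K)) :
    (opInv (Q * (1 + K))).domain ≠ (opInv (Q * (1 + -K))).domain := by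
  intro he
  have hi := injective_mul_one_add hQ hker (mul_neg_eq h)
  refine hU (ContinuousLinearMap.isUnit_iff_bijective.2 ⟨?_, fun x => ?_⟩)
  · rw [sub_eq_add_neg]
    exact Function.Injective.of_comp (f := Q) hi
  · have hx : (Q * (1 + K)) x ∈ (opInv (Q * (1 + K))).domain :=
      (mem_domain_opInv (injective_mul_one_add hQ hker h)).2 ⟨x, rfl⟩
    rw [he, mem_domain_opInv hi] at hx
    obtain ⟨y, hy⟩ := hx
    have h1 : (1 + -K) y = (1 + K) x := hker hy
    -- Since `(1 - K) y = (1 + K) x`, the operator `1 - K` sends `x + y` to `2 x`.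
    refine ⟨(2⁻¹ : ℂ) • (x + y), ?_⟩
    rw [← sub_eq_add_neg] at h1
    rw [map_smul, map_add, h1, ← add_apply]
    have h2 : (1 - K) + (1 + K) = (2 : ℂ) • (1 : H →L[ℂ] H) := by
      rw [two_smul]; abel
    rw [h2, smul_apply, one_apply_eq_self, smul_smul, inv_mul_cancel₀ two_ne_zero, one_smul]

theorem domain_opInv_inf_eq_bot (hQ : Q.IsPositive) (hker : Function.Injective Q)
    (h : Q * K = -(star K * Q)) (hK : Function.Injective K) {M : Submodule ℂ H}
    (hKM : ∀ x, K x ∈ M) (hMQ : M ⊓ LinearMap.range (Q : H →ₗ[ℂ] H) = ⊥) :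
    (opInv (Q * (1 + K) * (Q * (1 + K)))).domain ⊓
      (opInv (Q * (1 + -K) * (Q * (1 + -K)))).domain = ⊥ := by
  rw [eq_bot_iff]
  rintro z ⟨hz1, hz2⟩
  obtain ⟨x, rfl⟩ := (mem_domain_opInv (injective_mul_one_add_mul_self hQ hker h)).1 hz1
  obtain ⟨y, hy⟩ :=
    (mem_domain_opInv (injective_mul_one_add_mul_self hQ hker (mul_neg_eq h))).1 hz2
  set a := (1 + K) x with ha
  set b := (1 + -K) y with hb
  have h1 : Q b + -K (Q b) = Q a + K (Q a) := hker hy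
  -- The left side lies in `ran Q` and the right side in `M`, so both vanish; injectivity of `Q` and
  -- `K` then gives `b = a` and `a + b = 0`.
  have h2 : Q (b - a) = K (Q (a + b)) := by
    rw [map_sub, map_add, map_add, sub_eq_iff_eq_add]
    calc Q b = (Q b + -K (Q b)) + K (Q b) := by abel
      _ = _ := by rw [h1]; abel
  have h3 : Q (b - a) ∈ M ⊓ LinearMap.range (Q : H →ₗ[ℂ] H) :=
    ⟨by rw [h2]; exact hKM _, _, rfl⟩
  rw [hMQ, Submodule.mem_bot] at h3
  rw [h3] at h2
  have h4 : b - a = 0 := hker (h3.trans (map_zero Q).symm)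
  have h5 : a + b = 0 := hker ((hK (h2.symm.trans (map_zero K).symm)).trans (map_zero Q).symm)
  have h6 : (2 : ℂ) • a = 0 := by
    rw [sub_eq_zero.1 h4] at h5
    rwa [two_smul]
  have h7 : a = 0 := (smul_eq_zero.1 h6).resolve_left two_ne_zero
  rw [Submodule.mem_bot]
  change Q ((1 + K) (Q a)) = 0
  rw [h7, map_zero, map_zero, map_zero]

end Final

end KatoSqrt

end

theorem mainTheorem12 {H : Type*} [NormedAddCommGroup H] [InnerProductSpace ℂ H] [CompleteSpace H]
    (Q : H →L[ℂ] H) (hQ : Q.IsPositive) (hker : Function.Injective Q)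
    (hran : ¬ Function.Surjective Q)
    (M : Submodule ℂ H) [M.HasOrthogonalProjection] (hM : M ≠ ⊤)
    (hMQ : Mᗮ ⊓ LinearMap.range (Q : H →ₗ[ℂ] H) = ⊥) :
    (∀ t : ℝ, 0 ≤ t →
      -- the bounded operators below are injective, so their inverses are (unbounded) operators
      Function.Injective (Q * (1 + KatoSqrt.Z₀t hQ hker M t) * (1 - star (KatoSqrt.Z₀t hQ hker M t)) * Q :
        H →L[ℂ] H) ∧
      Function.Injective (Q * (1 + KatoSqrt.Z₀t hQ hker M t) :
        H →L[ℂ] H) ∧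
      KatoSqrt.B₀ hQ hker M t =
        KatoSqrt.opInv (Q * (1 + KatoSqrt.Z₀t hQ hker M t) * Q * (1 + KatoSqrt.Z₀t hQ hker M t)) ∧
      KatoSqrt.IsMAccretive (KatoSqrt.B₀ hQ hker M t) ∧
      -- the square roots of the operator and of its adjoint exist and are unique
      (∃! S, KatoSqrt.IsMAccretiveSqrt (KatoSqrt.B₀ hQ hker M t) S) ∧
      (∃! S, KatoSqrt.IsMAccretiveSqrt ((KatoSqrt.B₀ hQ hker M t)†) S) ∧
      KatoSqrt.mSqrt (KatoSqrt.B₀ hQ hker M t) =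
        KatoSqrt.opInv (Q * (1 + KatoSqrt.Z₀t hQ hker M t)) ∧
      KatoSqrt.mSqrt (KatoSqrt.B₀ hQ hker M t) =
        KatoSqrt.opInv ((1 - star (KatoSqrt.Z₀t hQ hker M t)) * Q) ∧
      (KatoSqrt.mSqrt (KatoSqrt.B₀ hQ hker M t)).domain ≠
        (KatoSqrt.mSqrt ((KatoSqrt.B₀ hQ hker M t)†)).domain) ∧
    KatoSqrt.NormResolventContinuousOn (KatoSqrt.B₀ hQ hker M) (Set.Ici 0) ∧
    (M ⊓ LinearMap.range (Q : H →ₗ[ℂ] H) = ⊥ →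
      ∀ t : ℝ, 0 ≤ t → (KatoSqrt.B₀ hQ hker M t).domain ⊓
        (KatoSqrt.B₀ hQ hker M t)†.domain = ⊥) := by
  have hskew : ∀ t : ℝ, Q * KatoSqrt.Z₀t hQ hker M t =
      -(star (KatoSqrt.Z₀t hQ hker M t) * Q) :=
    KatoSqrt.mul_expTwist_eq (KatoSqrt.mul_Z₀_eq hQ hker M)
  have hiso := KatoSqrt.star_Z₀_mul_self hQ hker M hMQ
  have hB : ∀ t : ℝ, KatoSqrt.B₀ hQ hker M t = KatoSqrt.opInv
      (Q * (1 + KatoSqrt.Z₀t hQ hker M t) * (Q * (1 + KatoSqrt.Z₀t hQ hker M t))) := fun t => by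
    rw [KatoSqrt.B₀, KatoSqrt.mul_one_add_mul_self (hskew t)]
  refine ⟨fun t ht => ?_, ?_, fun hM' t _ => ?_⟩
  · have h := hskew t
    have hinj := KatoSqrt.injective_mul_one_add_mul_self hQ hker h
    have hs := KatoSqrt.mSqrt_opInv_mul_self hQ hker h
    have hs' := KatoSqrt.mSqrt_opInv_mul_self hQ hker (KatoSqrt.mul_neg_eq h)
    rw [hB, KatoSqrt.adjoint_opInv_mul_one_add_mul_self hQ hker h, hs.2, hs'.2,
      ← KatoSqrt.mul_one_add_eq h, mul_assoc _ Q]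
    refine ⟨?_, KatoSqrt.injective_mul_one_add hQ hker h, rfl, ?_, hs.1, hs'.1, rfl, rfl, ?_⟩
    · rw [KatoSqrt.mul_one_add_mul_self h]
      exact hinj
    · exact KatoSqrt.isMAccretive_opInv hinj
        (KatoSqrt.denseRange_mul_one_add_mul_self hQ hker h)
        (KatoSqrt.re_inner_mul_self_nonneg hQ h (KatoSqrt.norm_expTwist_le hiso ht))
    · exact KatoSqrt.domain_opInv_ne hQ hker h
        (KatoSqrt.not_isUnit_one_sub_expTwist hiso (KatoSqrt.Z₀_mul_star_ne_one hQ hker M hM) t)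
  · rw [funext hB]
    refine KatoSqrt.normResolventContinuousOn_opInv
      (fun t _ => KatoSqrt.injective_mul_one_add_mul_self hQ hker (hskew t)) ?_
    have hc : Continuous (KatoSqrt.Z₀t hQ hker M) := KatoSqrt.continuous_expTwist _
    fun_prop
  · rw [hB, KatoSqrt.adjoint_opInv_mul_one_add_mul_self hQ hker (hskew t)]
    refine KatoSqrt.domain_opInv_inf_eq_bot hQ hker (hskew t)
      (KatoSqrt.injective_expTwist (KatoSqrt.injective_Z₀ hQ hker M hMQ) t) (fun x => ?_) hM'
    rw [← Submodule.starProjection_eq_self_iff]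
    have h1 := KatoSqrt.starProjection_mul_Z₀ hQ hker M
    change (M.starProjection * (KatoSqrt.Z₀ hQ hker M * _)) x = _
    rw [← mul_assoc, h1]
    rfl
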